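/- Let $N\ge 1$, $\lambda_1=\lambda_{1R}+\mathrm{i}\lambda_{1I}\in\mathbb{C}$ with $\lambda_{1I}\neq 0$, $\gamma,\delta\in\mathbb{R}$ and $a_1^{[0]},a_1^{[1]},a_1^{[2]},a_1^{[3]}\in\mathbb{C}$. For $x,t\in\mathbb{R}$ put $$\theta_1=\mathrm{i}\lambda_1\bigl(x+(2\gamma\lambda_1+4\delta\lambda_1^2)t\bigr)+a_1^{[0]}-\tfrac{\mathrm{i}}{4}\pi,\qquad \vartheta_{1,0}=-2\bigl[x+4\lambda_1(\gamma+3\delta\lambda_1)t\bigr]+2\mathrm{i}a_1^{[1]},$$ $$\vartheta_{1,1}=-4\mathrm{i}(\gamma+6\delta\lambda_1)t-2a_1^{[2]},\qquad \vartheta_{1,2}=8\delta t-2\mathrm{i}a_1^{[3]},$$ and for $l\ge 0$ $$f_{1,l}=\sum_{m=0}^{\lfloor 2l/3\rfloor}\ \sum_{k_0=\max(l-2m,0)}^{\lfloor l-3m/2\rfloor}\frac{\vartheta_{1,0}^{k_0}}{k_0!}\,\frac{\vartheta_{1,1}^{2l-2k_0-3m}}{(2l-2k_0-3m)!}\,\frac{\vartheta_{1,2}^{k_0-l+2m}}{(k_0-l+2m)!}$$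 (so $f_{1,0}=1$). Define the $N\times N$ matrices $$\mathbf{B}_1=\left(\frac{1}{\lambda_1-\lambda_1^*}\binom{i+j-2}{i-1}\Bigl(\frac{\mathrm{i}}{\lambda_1^*-\lambda_1}\Bigr)^{i+j-2}\right)_{1\le i,j\le N},\qquad \mathbf{F}_1=\mathrm{e}^{2\theta_1}\Bigl(\mathbb{I}+\sum_{l=1}^{N-1}f_{1,l}\mathbf{E}_N^l\Bigr),\quad \mathbf{E}_N=(\delta_{i,j-1})_{1\le i,j\le N}.$$ For $0\le j\le N$ let $$\Gamma_j=\det\Bigl(\tfrac{1}{(j+c-r)!}\Bigr)_{1\le r,c\le N-j}\qquad\bigl(\tfrac1{n!}:=0\text{ for }n<0,\ \Gamma_N:=1\bigr),$$ $$\mathscr{A}_j(x,t)=(-\mathrm{i})^N(2\lambda_{1I})^{-(N-j)^2-j^2}\,\Gamma_j^2\,|\vartheta_{1,0}|^{2j(N-j)}.$$ Then there are polynomials $R_1,\dots,R_{N-1}\in\mathbb{C}[x,t]$ (their coefficients may depend on all the data except $x$ and $t$) such that the total degree of $R_j$ in $(x,t)$ is strictly less than $2j(N-j)$, the degree of $\mathscr{A}_j$,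 and for all real $x,t$ $$\det(\mathbf{F}_1^{\dagger}\mathbf{B}_1\mathbf{F}_1+\mathbf{B}_1)=\sum_{j=0}^{N-1}\mathrm{e}^{2(N-j)(\theta_1+\theta_1^*)}\mathscr{A}_j(x,t)+\mathscr{A}_0(x,t)+\sum_{j=1}^{N-1}\mathrm{e}^{2(N-j)(\theta_1+\theta_1^*)}R_j(x,t).$$ -/

import Mathlib

noncomputable section

namespace HirotaSoliton

open ComplexConjugate

/-- The phase `θ₁` at the spectral parameter `lam = λ₁`, for the Hirota coefficients `γ`, `δ`;
`a k` is the free constant `a₁^{[k]}`. -/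
def theta (lam : ℂ) (γ δ : ℝ) (a : Fin 4 → ℂ) (x t : ℝ) : ℂ :=
  Complex.I * lam * (x + (2 * γ * lam + 4 * δ * lam ^ 2) * t) + a 0 - Complex.I / 4 * Real.pi

/-- `ϑ_{1,0}`. -/
def vartheta0 (lam : ℂ) (γ δ : ℝ) (a : Fin 4 → ℂ) (x t : ℝ) : ℂ :=
  -2 * (x + 4 * lam * (γ + 3 * δ * lam) * t) + 2 * Complex.I * a 1

/-- `ϑ_{1,1}`. -/
def vartheta1 (lam : ℂ) (γ δ : ℝ) (a : Fin 4 → ℂ) (t : ℝ) : ℂ :=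
  -4 * Complex.I * (γ + 6 * δ * lam) * t - 2 * a 2

/-- `ϑ_{1,2}`. -/
def vartheta2 (δ : ℝ) (a : Fin 4 → ℂ) (t : ℝ) : ℂ :=
  8 * δ * t - 2 * Complex.I * a 3

/-- The coefficient of `ε ^ l` in `exp (ε (v₀ + ε v₁ + ε² v₂))`, in closed form. The outer index is
`m = k₁ + 2 k₂`, so that `k₁ = 2 l - 2 k₀ - 3 m` and `k₂ = k₀ - l + 2 m` are natural numbers for all
`(m, k₀)` in the range of summation (no subtraction of exponents truncates there; the lower limit
`l - 2 * m` is the truncated one, `max (l - 2 m) 0`). -/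
def expCoeff (v₀ v₁ v₂ : ℂ) (l : ℕ) : ℂ :=
  ∑ m ∈ Finset.range (2 * l / 3 + 1), ∑ k₀ ∈ Finset.Icc (l - 2 * m) ((2 * l - 3 * m) / 2),
    v₀ ^ k₀ / (k₀.factorial : ℂ)
      * (v₁ ^ (2 * l - 2 * k₀ - 3 * m) / ((2 * l - 2 * k₀ - 3 * m).factorial : ℂ))
      * (v₂ ^ (k₀ + 2 * m - l) / ((k₀ + 2 * m - l).factorial : ℂ))

theorem expCoeff_zero (v₀ v₁ v₂ : ℂ) : expCoeff v₀ v₁ v₂ 0 = 1 := by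
  simp [expCoeff]

/-- `f_{1,l}`, evaluated at `(x, t)`. -/
def f (lam : ℂ) (γ δ : ℝ) (a : Fin 4 → ℂ) (x t : ℝ) (l : ℕ) : ℂ :=
  expCoeff (vartheta0 lam γ δ a x t) (vartheta1 lam γ δ a t) (vartheta2 δ a t) l

/-- The matrix `B₁` (row and column indices start at `0`). -/
def B (N : ℕ) (lam : ℂ) : Matrix (Fin N) (Fin N) ℂ :=
  Matrix.of fun i j =>
    1 / (lam - conj lam) * (((i : ℕ) + (j : ℕ)).choose (i : ℕ) : ℂ)
      * (Complex.I / (conj lam - lam)) ^ ((i : ℕ) + (j : ℕ))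

/-- The matrix `F₁`: `exp (2 θ₁)` times the upper triangular Toeplitz matrix with first row
`1, f_{1,1}, …, f_{1,N-1}` (recall `f_{1,0} = 1`). -/
def F (N : ℕ) (lam : ℂ) (γ δ : ℝ) (a : Fin 4 → ℂ) (x t : ℝ) : Matrix (Fin N) (Fin N) ℂ :=
  Complex.exp (2 * theta lam γ δ a x t) •
    Matrix.of fun i j : Fin N => if i ≤ j then f lam γ δ a x t ((j : ℕ) - (i : ℕ)) else 0

open scoped Matrix in
/-- The matrix `M = F₁† B₁ F₁ + B₁`, whose determinant is the denominator of the `N`-th order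
soliton. -/
def M (N : ℕ) (lam : ℂ) (γ δ : ℝ) (a : Fin 4 → ℂ) (x t : ℝ) : Matrix (Fin N) (Fin N) ℂ :=
  (F N lam γ δ a x t)ᴴ * B N lam * F N lam γ δ a x t + B N lam

/-- `Γ_j`: the determinant of the `(N - j) × (N - j)` matrix with entry `1 / (j + c - r)!` in row
`r` and column `c` (indices from `0`), where `1 / n!` means `0` for negative `n`. The empty
determinant `Γ_N` is `1`. -/
def Gam (N j : ℕ) : ℝ :=
  Matrix.det (Matrix.of fun r c : Fin (N - j) =>
    if (r : ℕ) ≤ j + (c : ℕ) then 1 / ((j + (c : ℕ) - (r : ℕ)).factorial : ℝ) else 0)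

/-- `𝒜_j (x, t) = (-i)^N (2 λ_{1I})^{-(N-j)²-j²} Γ_j² |ϑ_{1,0}|^{2j(N-j)}`. -/
def A (N : ℕ) (lam : ℂ) (γ δ : ℝ) (a : Fin 4 → ℂ) (j : ℕ) (x t : ℝ) : ℂ :=
  (-Complex.I) ^ N *
    (((2 * lam.im) ^ (-((N : ℤ) - (j : ℤ)) ^ 2 - (j : ℤ) ^ 2) * Gam N j ^ 2
      * ‖vartheta0 lam γ δ a x t‖ ^ (2 * j * (N - j)) : ℝ) : ℂ)

end HirotaSoliton

end

/-! Put `β = 1/(λ₁ - λ₁*)` and let `G` be the upper triangular Pascal matrix times `diag (q ^ i)`,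
`q = -1/(2 λ_{1I})`. Vandermonde's convolution gives `B₁ = β G†G`. If `U` is the Toeplitz factor of
`F₁`, then `W = G U G⁻¹` has entries polynomial in `(x, t)`, and the determinant becomes `β^N |det
G|² det (1 + |exp (2θ₁)|² W†W)`. Hence the coefficient of `exp (2k(θ₁ + θ₁*))` is `det B₁` times the
sum of the principal `k × k` minors of `W†W` (`det_M_eq_sum`). For `k = 0` and `k = N` that sum is
exactly `1`, because `det W = 1`.

For the other `k`, grade the entry `(i, j)` by `j - i`. Up to lower degree, `W` agrees with the
Toeplitz matrix of entries `w^(j-i)/(j-i)!`, `w = -2 λ_{1I} ϑ_{1,0}` (`conjToeplitz_sameTop`): terms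
with `ϑ_{1,1}` or `ϑ_{1,2}` lose degree, and constant unitriangular factors act as the identity in
top degree. By Cauchy–Binet a principal minor on columns `s` is a sum over row sets `I` of products
of degree at most `2(∑ s - ∑ I)`. The maximum `2k(N - k)` needs the last `k` columns and the first
`k` rows, so the top part is that of one squared corner minor (`sum_minors_sameTop`). With `k = N -
j` this is `Γ_j² |w|^(2j(N-j))` (`cornerMinor_leadToeplitz`), and `R_j` collects the rest. -/

noncomputable section

namespace HirotaSoliton

open MvPolynomial

/-! ### Degree filtration and equality of leading parts. -/

/-- The polynomials of total degree at most `z`, for an integer `z`; it is `0` for negative `z`. -/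
def degLE (σ R : Type*) [CommRing R] (z : ℤ) : Submodule R (MvPolynomial σ R) :=
  restrictSupport R {m | (m.degree : ℤ) ≤ z}

section Filtration

variable {σ R : Type*} [CommRing R]

theorem mem_degLE {z : ℤ} {p : MvPolynomial σ R} :
    p ∈ degLE σ R z ↔ ∀ m ∈ p.support, (m.degree : ℤ) ≤ z :=
  mem_restrictSupport_iff R

theorem degLE_mono {y z : ℤ} (h : y ≤ z) {p : MvPolynomial σ R} (hp : p ∈ degLE σ R y) :
    p ∈ degLE σ R z :=
  mem_degLE.2 fun m hm => (mem_degLE.1 hp m hm).trans h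

theorem mul_mem_degLE {y z : ℤ} {p q : MvPolynomial σ R} (hp : p ∈ degLE σ R y)
    (hq : q ∈ degLE σ R z) : p * q ∈ degLE σ R (y + z) := by
  classical
  refine mem_degLE.2 fun m hm => ?_
  obtain ⟨a, ha, b, hb, rfl⟩ := Finset.mem_add.1 (support_mul p q hm)
  have h1 := mem_degLE.1 hp a ha
  have h2 := mem_degLE.1 hq b hb
  rw [map_add]
  push_cast
  exact add_le_add h1 h2

theorem C_mem_degLE (c : R) {z : ℤ} (hz : 0 ≤ z) : (C c : MvPolynomial σ R) ∈ degLE σ R z := by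
  classical
  refine mem_degLE.2 fun m hm => ?_
  rw [mem_support_iff, coeff_C] at hm
  have : m = 0 := by
    by_contra h
    exact hm (if_neg fun h' => h h'.symm)
  simpa [this] using hz

theorem one_mem_degLE : (1 : MvPolynomial σ R) ∈ degLE σ R 0 := by
  simpa using C_mem_degLE (σ := σ) (1 : R) le_rfl

theorem X_mem_degLE (i : σ) : (X i : MvPolynomial σ R) ∈ degLE σ R 1 := by
  classical
  refine mem_degLE.2 fun m hm => ?_
  rw [mem_support_iff, coeff_X] at hm
  have : m = Finsupp.single i 1 := by
    by_contra h
    exact hm (if_neg fun h' => h h'.symm)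
  simp [this]

theorem C_mul_mem_degLE (c : R) {z : ℤ} {p : MvPolynomial σ R} (hp : p ∈ degLE σ R z) :
    C c * p ∈ degLE σ R z := by
  rw [C_mul']
  exact Submodule.smul_mem _ c hp

theorem prod_mem_degLE {ι : Type*} (s : Finset ι) (z : ι → ℤ) (p : ι → MvPolynomial σ R)
    (h : ∀ i ∈ s, p i ∈ degLE σ R (z i)) : ∏ i ∈ s, p i ∈ degLE σ R (∑ i ∈ s, z i) := by
  classical
  induction s using Finset.induction_on with
  | empty => simpa using one_mem_degLE
  | insert a s ha ih =>
    rw [Finset.prod_insert ha, Finset.sum_insert ha]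
    exact mul_mem_degLE (h a (Finset.mem_insert_self a s))
      (ih fun i hi => h i (Finset.mem_insert_of_mem hi))

theorem pow_mem_degLE {p : MvPolynomial σ R} (hp : p ∈ degLE σ R 1) (n : ℕ) :
    p ^ n ∈ degLE σ R n := by
  simpa using prod_mem_degLE (Finset.range n) (fun _ => 1) (fun _ => p) fun _ _ => hp

theorem totalDegree_lt_of_mem_degLE {n : ℕ} (hn : 0 < n) {p : MvPolynomial σ R}
    (hp : p ∈ degLE σ R (n - 1)) : p.totalDegree < n := by
  rw [totalDegree, Finset.sup_lt_iff (by simpa using hn)]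
  intro m hm
  have := mem_degLE.1 hp m hm
  change m.degree < n
  omega

theorem map_mem_degLE {S : Type*} [CommRing S] (φ : R →+* S) {z : ℤ} {p : MvPolynomial σ R}
    (hp : p ∈ degLE σ R z) : map φ p ∈ degLE σ S z :=
  mem_degLE.2 fun m hm => mem_degLE.1 hp m (support_map_subset φ p hm)

/-- `p` and `q` have degree at most `z` and the same homogeneous part of degree `z`. -/
structure SameTop (z : ℤ) (p q : MvPolynomial σ R) : Prop where
  left : p ∈ degLE σ R z
  right : q ∈ degLE σ R z
  sub : p - q ∈ degLE σ R (z - 1)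

namespace SameTop

variable {y z : ℤ} {p q r s : MvPolynomial σ R}

theorem refl (hp : p ∈ degLE σ R z) : SameTop z p p :=
  ⟨hp, hp, by simp⟩

theorem of_mem (hp : p ∈ degLE σ R (z - 1)) : SameTop z p 0 :=
  ⟨degLE_mono (by lia) hp, zero_mem _, by simpa using hp⟩

theorem trans (h : SameTop z p q) (h' : SameTop z q r) : SameTop z p r :=
  ⟨h.left, h'.right, by simpa using add_mem h.sub h'.sub⟩

theorem add (h : SameTop z p q) (h' : SameTop z r s) : SameTop z (p + r) (q + s) :=
  ⟨add_mem h.left h'.left, add_mem h.right h'.right, by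
    rw [add_sub_add_comm]
    exact add_mem h.sub h'.sub⟩

theorem sum {ι : Type*} (t : Finset ι) (f g : ι → MvPolynomial σ R)
    (h : ∀ i ∈ t, SameTop z (f i) (g i)) : SameTop z (∑ i ∈ t, f i) (∑ i ∈ t, g i) :=
  ⟨sum_mem fun i hi => (h i hi).left, sum_mem fun i hi => (h i hi).right, by
    rw [← Finset.sum_sub_distrib]
    exact sum_mem fun i hi => (h i hi).sub⟩

theorem mul (h : SameTop y p q) (h' : SameTop z r s) : SameTop (y + z) (p * r) (q * s) :=
  ⟨mul_mem_degLE h.left h'.left, mul_mem_degLE h.right h'.right, by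
    have e : p * r - q * s = (p - q) * r + q * (r - s) := by ring
    rw [e]
    refine add_mem ?_ ?_
    · exact degLE_mono (by lia) (mul_mem_degLE h.sub h'.left)
    · exact degLE_mono (by lia) (mul_mem_degLE h.right h'.sub)⟩

theorem smul (h : SameTop z p q) (c : R) : SameTop z (c • p) (c • q) :=
  ⟨Submodule.smul_mem _ c h.left, Submodule.smul_mem _ c h.right, by
    rw [← smul_sub]
    exact Submodule.smul_mem _ c h.sub⟩

theorem prod {ι : Type*} (t : Finset ι) (z : ι → ℤ) (f g : ι → MvPolynomial σ R)
    (h : ∀ i ∈ t, SameTop (z i) (f i) (g i)) :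
    SameTop (∑ i ∈ t, z i) (∏ i ∈ t, f i) (∏ i ∈ t, g i) := by
  classical
  induction t using Finset.induction_on with
  | empty => simpa using refl one_mem_degLE
  | insert a t ha ih =>
    rw [Finset.prod_insert ha, Finset.prod_insert ha, Finset.sum_insert ha]
    exact (h a (Finset.mem_insert_self a t)).mul
      (ih fun i hi => h i (Finset.mem_insert_of_mem hi))

theorem map {S : Type*} [CommRing S] (φ : R →+* S) (h : SameTop z p q) :
    SameTop z (MvPolynomial.map φ p) (MvPolynomial.map φ q) :=
  ⟨map_mem_degLE φ h.left, map_mem_degLE φ h.right, by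
    rw [← map_sub]
    exact map_mem_degLE φ h.sub⟩

/-- Row weights are merely reindexed by a permutation, so every term of the Leibniz expansion has
the same degree bound `∑ b - ∑ a`. Integer weights let entries of negative weight be zero without a
case split. -/
theorem det {n : Type*} [Fintype n] [DecidableEq n] (a b : n → ℤ)
    (M M' : Matrix n n (MvPolynomial σ R))
    (h : ∀ i j, SameTop (b j - a i) (M i j) (M' i j)) :
    SameTop (∑ i, b i - ∑ i, a i) M.det M'.det := by
  rw [Matrix.det_apply, Matrix.det_apply]
  refine sum _ _ _ fun τ _ => ?_
  have key := prod Finset.univ (fun i => b i - a (τ i)) (fun i => M (τ i) i)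
    (fun i => M' (τ i) i) fun i _ => h (τ i) i
  rw [Finset.sum_sub_distrib, Equiv.sum_comp τ a] at key
  rcases Int.units_eq_one_or (Equiv.Perm.sign τ) with hs | hs
  · simpa [hs] using key
  · simpa [hs, neg_smul] using key.smul (-1 : R)

/-- The relation is multiplicative for matrices graded by the column index minus the row index. -/
theorem matrix_mul {l m n : Type*} [Fintype m] (a : l → ℤ) (b : m → ℤ) (c : n → ℤ)
    {M M' : Matrix l m (MvPolynomial σ R)} {K K' : Matrix m n (MvPolynomial σ R)}
    (h : ∀ i j, SameTop (b j - a i) (M i j) (M' i j))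
    (h' : ∀ i j, SameTop (c j - b i) (K i j) (K' i j)) (i : l) (j : n) :
    SameTop (c j - a i) ((M * K) i j) ((M' * K') i j) := by
  rw [Matrix.mul_apply, Matrix.mul_apply]
  refine sum _ _ _ fun k _ => ?_
  have := (h i k).mul (h' k j)
  rwa [show b k - a i + (c j - b k) = c j - a i by ring] at this

end SameTop

end Filtration

/-! ### Cauchy–Binet expansion. -/

section CauchyBinet

variable {R : Type*} [CommRing R]

/-- The Cauchy–Binet expansion before collecting the terms with the same image. -/
theorem det_mul_eq_sum_fun {m n : Type*} [Fintype m] [DecidableEq m] [Fintype n]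
    (A : Matrix m n R) (B : Matrix n m R) :
    (A * B).det = ∑ g : m → n, (∏ i, A i (g i)) * (B.submatrix g id).det := by
  classical
  have h : (A * B) = fun i => ∑ j, A i j • B j := by
    ext i k
    simp [Matrix.mul_apply, Finset.sum_apply]
  rw [h]
  change Matrix.detRowAlternating.toMultilinearMap (fun i => ∑ j, A i j • B j) = _
  rw [MultilinearMap.map_sum]
  refine Finset.sum_congr rfl fun g _ => ?_
  rw [MultilinearMap.map_smul_univ]
  rfl

end CauchyBinet

/-- The values of `g` outside `range n` are as many as the elements of `range n` that are missed.
The former are at least `n`, the latter less than `n`, so each exchange strictly increases the sum.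
-/
theorem sum_range_id_le_sum_of_injOn {ι : Type*} (s : Finset ι) (g : ι → ℕ)
    (hg : Set.InjOn g s) :
    ∑ i ∈ Finset.range s.card, i ≤ ∑ i ∈ s, g i ∧
      ((∃ i ∈ s, s.card ≤ g i) → ∑ i ∈ Finset.range s.card, i < ∑ i ∈ s, g i) := by
  classical
  have hc : (s.image g).card = s.card := Finset.card_image_of_injOn hg
  have hs : ∑ i ∈ s.image g, i = ∑ i ∈ s, g i := Finset.sum_image hg
  generalize hn : s.card = n at *
  rw [← hs]
  have h1 := Finset.sum_sdiff (Finset.inter_subset_left : s.image g ∩ Finset.range n ⊆ s.image g)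
    (f := fun i => i)
  have h2 := Finset.sum_sdiff (Finset.inter_subset_right : s.image g ∩ Finset.range n ⊆
    Finset.range n) (f := fun i => i)
  have hcard : (Finset.range n \ (s.image g ∩ Finset.range n)).card =
      (s.image g \ (s.image g ∩ Finset.range n)).card := by
    rw [Finset.card_sdiff_of_subset Finset.inter_subset_right,
      Finset.card_sdiff_of_subset Finset.inter_subset_left, hc, Finset.card_range]
  have hlow : n * (s.image g \ (s.image g ∩ Finset.range n)).card ≤
      ∑ i ∈ s.image g \ (s.image g ∩ Finset.range n), i := by
    rw [mul_comm]
    refine Finset.card_nsmul_le_sum _ _ _ fun i hi => ?_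
    simp only [Finset.mem_sdiff, Finset.mem_inter, Finset.mem_range] at hi
    by_contra h
    exact hi.2 ⟨hi.1, by lia⟩
  have hup : ∑ i ∈ Finset.range n \ (s.image g ∩ Finset.range n), (i + 1) ≤
      n * (Finset.range n \ (s.image g ∩ Finset.range n)).card := by
    rw [mul_comm]
    refine Finset.sum_le_card_nsmul _ _ _ fun i hi => ?_
    simp only [Finset.mem_sdiff, Finset.mem_range] at hi
    lia
  rw [Finset.sum_add_distrib, Finset.sum_const, smul_eq_mul, mul_one, hcard] at hup
  refine ⟨by lia, ?_⟩
  rintro ⟨i, hi, hin⟩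
  have : 0 < (s.image g \ (s.image g ∩ Finset.range n)).card := by
    refine Finset.card_pos.2 ⟨g i, ?_⟩
    simp only [Finset.mem_sdiff, Finset.mem_inter, Finset.mem_range]
    exact ⟨Finset.mem_image_of_mem g hi, fun h => by lia⟩
  lia

/-! ### Leading part of the sums of principal minors. -/

section Minors

variable {σ R : Type*} [CommRing R]

/-- The minor of `T` in the first `k` rows and the last `k` columns. -/
def cornerMinor {S : Type*} [CommRing S] {N k : ℕ} (hk : k ≤ N) (T : Matrix (Fin N) (Fin N) S) :
    S :=
  (T.submatrix (fun r : Fin k => (⟨r, by lia⟩ : Fin N))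
    (fun c : Fin k => (⟨N - k + c, by lia⟩ : Fin N))).det

theorem SameTop.cornerMinor {N k : ℕ} (hk : k ≤ N)
    {T T₀ : Matrix (Fin N) (Fin N) (MvPolynomial σ R)}
    (hT : ∀ i j : Fin N, SameTop ((j : ℤ) - (i : ℤ)) (T i j) (T₀ i j)) :
    SameTop ((k : ℤ) * (N - k)) (cornerMinor hk T) (cornerMinor hk T₀) := by
  have := SameTop.det (fun r : Fin k => (r : ℤ)) (fun c : Fin k => ((N - k + c : ℕ) : ℤ))
    (T.submatrix (fun r : Fin k => (⟨r, by lia⟩ : Fin N))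
      (fun c : Fin k => (⟨N - k + c, by lia⟩ : Fin N)))
    (T₀.submatrix (fun r : Fin k => (⟨r, by lia⟩ : Fin N))
      (fun c : Fin k => (⟨N - k + c, by lia⟩ : Fin N))) fun i j =>
        hT ⟨i, by lia⟩ ⟨N - k + j, by lia⟩
  rwa [← Finset.sum_sub_distrib, Finset.sum_congr rfl fun c _ =>
    show ((N - k + (c : Fin k) : ℕ) : ℤ) - ((c : ℕ) : ℤ) = N - k by lia, Finset.sum_const, Finset.card_fin,
    nsmul_eq_mul] at this

variable {N k : ℕ} {T T' : Matrix (Fin N) (Fin N) (MvPolynomial σ R)}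

/-- The extremal-sum bound is used twice: for the rows `g i`, and for the columns reversed by `i ↦ N
- 1 - i`. -/
theorem sum_val_le_of_injective {s : Finset (Fin N)} (hs : s.card = k) {g : s → Fin N}
    (hg : Function.Injective g) :
    ((∑ i : s, ((i : Fin N) : ℤ)) - ∑ i, (g i : ℤ) ≤ k * (N - k)) ∧
      (((∃ i : s, k ≤ g i) ∨ ∃ i : s, k ≤ N - 1 - (i : Fin N)) →
        (∑ i : s, ((i : Fin N) : ℤ)) - ∑ i, (g i : ℤ) < k * (N - k)) := by
  obtain ⟨h1, h2⟩ := sum_range_id_le_sum_of_injOn (Finset.univ : Finset s)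
    (fun i => (g i : ℕ)) fun x _ y _ h => hg (Fin.ext h)
  obtain ⟨h3, h4⟩ := sum_range_id_le_sum_of_injOn (Finset.univ : Finset s)
    (fun i => N - 1 - ((i : Fin N) : ℕ)) fun x _ y _ h => by
      have hx := x.1.2
      have hy := y.1.2
      exact Subtype.ext (Fin.ext (by lia))
  have hcard : (Finset.univ : Finset s).card = k := by simpa using hs
  rw [hcard] at h1 h2 h3 h4
  have e : ((∑ i : s, (N - 1 - ((i : Fin N) : ℕ)) : ℕ) : ℤ) =
      k * (N - 1) - ∑ i : s, ((i : Fin N) : ℤ) := by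
    rw [Nat.cast_sum, ← hcard, ← nsmul_eq_mul, ← Finset.sum_const, ← Finset.sum_sub_distrib]
    refine Finset.sum_congr rfl fun i _ => ?_
    have := i.1.2
    lia
  have e' : ((∑ i : s, (g i : ℕ) : ℕ) : ℤ) = ∑ i, (g i : ℤ) := Nat.cast_sum _ _
  have h5 := Finset.sum_range_id_mul_two k
  have h6 : ((k * (k - 1) : ℕ) : ℤ) = k * k - k := by
    rcases k with _ | k
    · simp
    · rw [Nat.add_sub_cancel]
      push_cast
      ring
  have h7 : (k : ℤ) * (N - k) = k * (N - 1) - (k * k - k) := by ring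
  refine ⟨by lia, ?_⟩
  rintro (⟨i, hi⟩ | ⟨i, hi⟩)
  · have := h2 ⟨i, Finset.mem_univ _, hi⟩
    lia
  · have := h4 ⟨i, Finset.mem_univ _, hi⟩
    lia

/-- Both factors have degree at most `∑ i - ∑ g i`, which accounts for the 2. A non-injective `g`
repeats a row, and the determinant vanishes. -/
theorem minor_term_mem_degLE (hT : ∀ i j : Fin N, T i j ∈ degLE σ R ((j : ℤ) - (i : ℤ)))
    (hT' : ∀ i j : Fin N, T' i j ∈ degLE σ R ((j : ℤ) - (i : ℤ))) {s : Finset (Fin N)}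
    (hs : s.card = k) (g : s → Fin N) :
    (∏ i, T' (g i) i) * (T.submatrix g Subtype.val).det ∈ degLE σ R (2 * k * (N - k)) ∧
      (((∃ i : s, k ≤ g i) ∨ ∃ i : s, k ≤ N - 1 - (i : Fin N)) →
        (∏ i, T' (g i) i) * (T.submatrix g Subtype.val).det ∈
          degLE σ R (2 * k * (N - k) - 1)) := by
  by_cases hg : Function.Injective g
  · have h1 := prod_mem_degLE Finset.univ (fun i : s => ((i : Fin N) : ℤ) - (g i : ℤ))
      (fun i => T' (g i) i) fun i _ => hT' _ _
    have h2 := (SameTop.det (fun i : s => (g i : ℤ)) (fun i : s => ((i : Fin N) : ℤ))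
      (T.submatrix g Subtype.val) (T.submatrix g Subtype.val)
      fun i j => SameTop.refl (hT _ _)).left
    rw [Finset.sum_sub_distrib] at h1
    have h3 := mul_mem_degLE h1 h2
    obtain ⟨h4, h5⟩ := sum_val_le_of_injective hs hg
    refine ⟨degLE_mono (by lia) h3, fun h => degLE_mono ?_ h3⟩
    have := h5 h
    lia
  · have : (T.submatrix g Subtype.val).det = 0 := by
      simp only [Function.Injective, not_forall] at hg
      obtain ⟨x, y, hxy, hne⟩ := hg
      exact Matrix.det_zero_of_row_eq hne (by ext; simp [hxy])
    rw [this, mul_zero]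
    exact ⟨zero_mem _, fun _ => zero_mem _⟩

theorem det_submatrix_transpose_mul {m n S : Type*} [CommRing S] [Fintype m] [DecidableEq m]
    [Fintype n] (A B : Matrix n n S) (u : m → n) :
    ((Matrix.transpose A * B).submatrix u u).det =
      ∑ g : m → n, (∏ i, A (g i) (u i)) * (B.submatrix g u).det := by
  rw [← Matrix.submatrix_mul_equiv _ _ u (Equiv.refl n) u, det_mul_eq_sum_fun]
  rfl

/-- The minors of `T'ᵀ T` other than the last one do not contribute in top degree. -/
theorem minor_mem_degLE (hT : ∀ i j : Fin N, T i j ∈ degLE σ R ((j : ℤ) - (i : ℤ)))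
    (hT' : ∀ i j : Fin N, T' i j ∈ degLE σ R ((j : ℤ) - (i : ℤ))) {s : Finset (Fin N)}
    (hs : s.card = k) (h : ∃ i ∈ s, k ≤ N - 1 - (i : ℕ)) :
    ((Matrix.transpose T' * T).submatrix (Subtype.val : s → Fin N) Subtype.val).det ∈
      degLE σ R (2 * k * (N - k) - 1) := by
  rw [det_submatrix_transpose_mul]
  obtain ⟨i, hi, hik⟩ := h
  exact sum_mem fun g _ => (minor_term_mem_degLE hT hT' hs g).2 (Or.inr ⟨⟨i, hi⟩, hik⟩)

theorem last_minor_sameTop (hk : k ≤ N) (hT : ∀ i j : Fin N, T i j ∈ degLE σ R ((j : ℤ) - (i : ℤ)))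
    (hT' : ∀ i j : Fin N, T' i j ∈ degLE σ R ((j : ℤ) - (i : ℤ))) {s : Finset (Fin N)}
    (hs : s = Finset.univ.filter fun i : Fin N => N - k ≤ i) (hcard : s.card = k) :
    SameTop (2 * k * (N - k) : ℤ)
      ((Matrix.transpose T' * T).submatrix (Subtype.val : s → Fin N) Subtype.val).det
      (cornerMinor hk T' * cornerMinor hk T) := by
  have hterm := minor_term_mem_degLE hT hT' hcard
  have hmem : ∀ c : Fin k, (⟨N - k + c, by lia⟩ : Fin N) ∈ s := fun c => by
    simp only [hs, Finset.mem_filter, Finset.mem_univ, true_and]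
    lia
  let e : Fin k ≃ s := Equiv.ofBijective (fun c => ⟨⟨N - k + c, by lia⟩, hmem c⟩) <| by
    constructor
    · intro x y h
      simp only [Subtype.mk.injEq, Fin.mk.injEq] at h
      exact Fin.ext (by lia)
    · rintro ⟨i, hi⟩
      simp only [hs, Finset.mem_filter, Finset.mem_univ, true_and] at hi
      exact ⟨⟨i - (N - k), by lia⟩, by simp; exact Fin.ext (by simp; lia)⟩
  let A : Matrix s (Fin k) (MvPolynomial σ R) := fun i r => T' ⟨r, by lia⟩ i
  let B : Matrix (Fin k) s (MvPolynomial σ R) := fun r i => T ⟨r, by lia⟩ i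
  have hcorner : cornerMinor hk T' * cornerMinor hk T = (A * B).det := by
    rw [← Matrix.det_submatrix_equiv_self e (A * B),
      ← Matrix.submatrix_mul_equiv A B e (Equiv.refl (Fin k)) e, Matrix.det_mul,
      ← Matrix.det_transpose (A.submatrix _ _)]
    rfl
  let ι : Fin k → Fin N := fun r => ⟨r, by lia⟩
  have hι : Function.Injective ι := fun x y h => Fin.ext (by simpa [ι] using h)
  -- Maps with all values below `k` form exactly the expansion through the first `k` rows, whose
  -- determinant factors into two corner minors. Any other map loses degree.
  have hsum : (A * B).det = ∑ g : s → Fin N, if ∀ i, (g i : ℕ) < k then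
      (∏ i, T' (g i) i) * (T.submatrix g Subtype.val).det else 0 := by
    rw [det_mul_eq_sum_fun, ← Finset.sum_filter]
    refine Finset.sum_bij (fun g _ i => ι (g i)) ?_ ?_ ?_ ?_
    · intro g _
      simp [ι]
    · intro g _ g' _ h
      funext i
      exact hι (congrFun h i)
    · intro g hg
      simp only [Finset.mem_filter, Finset.mem_univ, true_and] at hg
      exact ⟨fun i => ⟨g i, hg i⟩, Finset.mem_univ _, rfl⟩
    · intro g _
      rfl
  rw [hcorner, hsum, det_submatrix_transpose_mul]
  refine SameTop.sum _ _ _ fun g _ => ?_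
  split_ifs with h
  · exact SameTop.refl (hterm g).1
  · push Not at h
    exact SameTop.of_mem ((hterm g).2 (Or.inl h))

/-- The leading part of the sum of the principal `k × k` minors of `T'ᵀ T`. -/
theorem sum_minors_sameTop (hk : k ≤ N) (hT : ∀ i j : Fin N, T i j ∈ degLE σ R ((j : ℤ) - (i : ℤ)))
    (hT' : ∀ i j : Fin N, T' i j ∈ degLE σ R ((j : ℤ) - (i : ℤ))) :
    SameTop (2 * k * (N - k) : ℤ)
      (∑ s ∈ (Finset.univ : Finset (Fin N)).powersetCard k,
        ((Matrix.transpose T' * T).submatrix (Subtype.val : s → Fin N) Subtype.val).det)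
      (cornerMinor hk T' * cornerMinor hk T) := by
  classical
  set s₀ : Finset (Fin N) := Finset.univ.filter fun i : Fin N => N - k ≤ i with hs₀
  have hcard : s₀.card = k := by
    have : s₀ = Finset.univ.image fun c : Fin k => (⟨N - k + c, by lia⟩ : Fin N) := by
      ext i
      simp only [hs₀, Finset.mem_filter, Finset.mem_univ, true_and, Finset.mem_image, Fin.ext_iff]
      exact ⟨fun h => ⟨⟨i - (N - k), by lia⟩, by simp only; lia⟩, fun ⟨c, hc⟩ => by lia⟩
    rw [this, Finset.card_image_of_injective _ fun x y h => ?_, Finset.card_fin]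
    simp only [Fin.mk.injEq] at h
    exact Fin.ext (by lia)
  have hmem : s₀ ∈ (Finset.univ : Finset (Fin N)).powersetCard k := by simp [hcard]
  rw [← Finset.add_sum_erase _ _ hmem, ← add_zero (cornerMinor hk T' * cornerMinor hk T)]
  refine (last_minor_sameTop hk hT hT' hs₀ hcard).add (SameTop.of_mem (sum_mem fun s hs => ?_))
  simp only [Finset.mem_erase, Finset.mem_powersetCard, Finset.subset_univ, true_and] at hs
  refine minor_mem_degLE hT hT' hs.2 ?_
  -- If the bound fails for every index of `s`, then `s` lies in the last block, and equal
  -- cardinality makes it that block.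
  by_contra! h
  refine hs.1 (Finset.eq_of_subset_of_card_le (fun i hi => ?_) (by rw [hcard, hs.2]))
  have := h i hi
  simp only [hs₀, Finset.mem_filter, Finset.mem_univ, true_and]
  lia

end Minors

/-! ### Expansion of the determinant in principal minors. -/

/-- `det (1 + c M)` is a polynomial in `c` with the sums of principal minors as coefficients. -/
theorem det_one_add_smul_eq_sum_minors {R : Type*} [CommRing R] {n : Type*} [Fintype n]
    [DecidableEq n] (c : R) (M : Matrix n n R) :
    (1 + c • M).det = ∑ k ∈ Finset.range (Fintype.card n + 1), c ^ k *
      ∑ s ∈ (Finset.univ : Finset n).powersetCard k,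
        (M.submatrix (Subtype.val : s → n) Subtype.val).det := by
  have h1 : (1 + c • M).det =
      (1 + (Polynomial.X : Polynomial R) • M.map Polynomial.C).det.eval c := by
    rw [← Polynomial.coe_evalRingHom, RingHom.map_det]
    congr 1
    ext i j
    simp [Matrix.one_apply, apply_ite (Polynomial.eval c), mul_comm c]
  have hdeg : (1 + (Polynomial.X : Polynomial R) • M.map Polynomial.C).det.natDegree <
      Fintype.card n + 1 := by
    have := Polynomial.natDegree_det_X_add_C_le M (1 : Matrix n n R)
    rw [Matrix.map_one _ (map_zero _) (map_one _), add_comm] at this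
    lia
  rw [h1, Polynomial.eval_eq_sum_range' hdeg]
  refine Finset.sum_congr rfl fun k _ => ?_
  rw [Matrix.coeff_det_one_add_X_smul_eq_sum_minors, mul_comm]

open ComplexConjugate Matrix

/-! ### The Pascal matrix and its inverse. -/

section Pascal

/-- The upper triangular Pascal matrix. -/
def pascal (N : ℕ) : Matrix (Fin N) (Fin N) ℂ :=
  Matrix.of fun i j => ((j : ℕ).choose i : ℂ)

/-- Vandermonde's convolution, after replacing `choose i (i - k)` by `choose i k`. -/
theorem pascal_transpose_mul (N : ℕ) (i j : Fin N) :
    ((pascal N)ᵀ * pascal N) i j = (((i : ℕ) + (j : ℕ)).choose (i : ℕ) : ℂ) := by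
  have h : ∑ k ∈ Finset.range N, (i : ℕ).choose k * (j : ℕ).choose k =
      ((i : ℕ) + (j : ℕ)).choose (i : ℕ) := by
    rw [add_comm, Nat.add_choose_eq, Finset.Nat.sum_antidiagonal_eq_sum_range_succ_mk]
    rw [← Finset.sum_subset (Finset.range_mono (by lia : (i : ℕ).succ ≤ N))]
    · refine Finset.sum_congr rfl fun k hk => ?_
      rw [Nat.choose_symm (by simpa [Nat.lt_succ_iff] using hk), mul_comm]
    · intro k _ hk
      rw [Nat.choose_eq_zero_of_lt (by simpa using hk), zero_mul]
  rw [← h, Matrix.mul_apply, ← Fin.sum_univ_eq_sum_range (fun k =>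
    (i : ℕ).choose k * (j : ℕ).choose k)]
  simp [pascal]

theorem pascal_blockTriangular (N : ℕ) : (pascal N).BlockTriangular id := fun i j h => by
  simp only [pascal, Matrix.of_apply]
  rw [Nat.choose_eq_zero_of_lt (by simpa using h), Nat.cast_zero]

theorem det_pascal (N : ℕ) : (pascal N).det = 1 := by
  rw [Matrix.det_of_isUpperTriangular (pascal_blockTriangular N)]
  simp [pascal]

theorem inv_blockTriangular (N : ℕ) : ((pascal N)⁻¹).BlockTriangular id := by
  have : Invertible (pascal N) := Matrix.invertibleOfIsUnitDet _ (by simp [det_pascal])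
  exact Matrix.blockTriangular_inv_of_blockTriangular (pascal_blockTriangular N)

theorem pascal_inv_mul (N : ℕ) : (pascal N)⁻¹ * pascal N = 1 :=
  Matrix.nonsing_inv_mul _ (by simp [det_pascal])

theorem pascal_inv_diag (N : ℕ) (i : Fin N) : (pascal N)⁻¹ i i = 1 := by
  have h := congrFun (congrFun (pascal_inv_mul N) i) i
  rw [Matrix.mul_apply, Finset.sum_eq_single i] at h
  · simpa [pascal] using h
  · intro k _ hk
    rcases lt_or_gt_of_ne hk with h | h
    · rw [inv_blockTriangular N (by simpa using h), zero_mul]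
    · rw [pascal_blockTriangular N (by simpa using h), mul_zero]
  · simp

end Pascal

/-- A constant unitriangular matrix has the same leading part as the identity. -/
theorem sameTop_of_unitriangular {σ : Type*} {N : ℕ} {K : Matrix (Fin N) (Fin N) ℂ}
    (hK : K.BlockTriangular id) (hd : ∀ i, K i i = 1) (i j : Fin N) :
    SameTop ((j : ℤ) - (i : ℤ)) (K.map C i j : MvPolynomial σ ℂ)
      ((1 : Matrix (Fin N) (Fin N) (MvPolynomial σ ℂ)) i j) := by
  rw [Matrix.map_apply]
  rcases lt_trichotomy i j with h | rfl | h
  · rw [Matrix.one_apply_ne h.ne]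
    -- A constant has degree `0 ≤ j - i - 1` here, strictly below the weight of the entry.
    exact SameTop.of_mem (C_mem_degLE _ (by have : (i : ℕ) < j := h; lia))
  · rw [hd, Matrix.one_apply_eq, map_one, sub_self]
    exact SameTop.refl one_mem_degLE
  · rw [hK (by simpa using h), Matrix.one_apply_ne h.ne', map_zero]
    exact SameTop.refl (zero_mem _)

/-! ### Leading parts of the Toeplitz entries. -/

section ExpCoeff

variable {σ : Type*}

/-- `expCoeff` with polynomial arguments. -/
def expCoeffPoly (v₀ v₁ v₂ : MvPolynomial σ ℂ) (l : ℕ) : MvPolynomial σ ℂ :=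
  ∑ m ∈ Finset.range (2 * l / 3 + 1), ∑ k₀ ∈ Finset.Icc (l - 2 * m) ((2 * l - 3 * m) / 2),
    C ((k₀.factorial : ℂ)⁻¹ * ((2 * l - 2 * k₀ - 3 * m).factorial : ℂ)⁻¹ *
        ((k₀ + 2 * m - l).factorial : ℂ)⁻¹) *
      (v₀ ^ k₀ * v₁ ^ (2 * l - 2 * k₀ - 3 * m) * v₂ ^ (k₀ + 2 * m - l))

theorem eval_expCoeffPoly (u : σ → ℂ) (v₀ v₁ v₂ : MvPolynomial σ ℂ) (l : ℕ) :
    eval u (expCoeffPoly v₀ v₁ v₂ l) = expCoeff (eval u v₀) (eval u v₁) (eval u v₂) l := by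
  simp only [expCoeffPoly, expCoeff, map_sum, map_mul, eval_C, map_pow]
  refine Finset.sum_congr rfl fun m _ => Finset.sum_congr rfl fun k _ => ?_
  simp only [div_eq_mul_inv]
  ring

/-- The exponents in a term with outer index `m` add up to `l - m`, so only `m = 0` reaches degree
`l`, and there `k₀ = l` is forced. -/
theorem expCoeffPoly_sameTop {v₀ v₁ v₂ : MvPolynomial σ ℂ} (h₀ : v₀ ∈ degLE σ ℂ 1)
    (h₁ : v₁ ∈ degLE σ ℂ 1) (h₂ : v₂ ∈ degLE σ ℂ 1) (l : ℕ) :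
    SameTop (l : ℤ) (expCoeffPoly v₀ v₁ v₂ l) (C (l.factorial : ℂ)⁻¹ * v₀ ^ l) := by
  rw [expCoeffPoly, Finset.sum_range_succ', ← zero_add (C _ * _)]
  refine SameTop.add (SameTop.of_mem ?_) ?_
  · refine sum_mem fun m hm => sum_mem fun k hk => C_mul_mem_degLE _ ?_
    rw [Finset.mem_range] at hm
    rw [Finset.mem_Icc] at hk
    refine degLE_mono ?_ (mul_mem_degLE (mul_mem_degLE (pow_mem_degLE h₀ k)
      (pow_mem_degLE h₁ _)) (pow_mem_degLE h₂ _))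
    lia
  · have h : (2 * l - 3 * 0) / 2 = l - 2 * 0 := by lia
    rw [h, Finset.Icc_self, Finset.sum_singleton]
    have h' : 2 * l - 2 * l = 0 := by lia
    simpa [h'] using SameTop.refl (C_mul_mem_degLE (l.factorial : ℂ)⁻¹ (pow_mem_degLE h₀ l))

end ExpCoeff

/-! ### The phases as polynomials and the conjugated Toeplitz matrix. -/

section Phases

variable (N : ℕ) (lam : ℂ) (γ δ : ℝ) (a : Fin 4 → ℂ)

/-- `ϑ_{1,0}` as a polynomial in `(x, t)`. -/
def vartheta0Poly : MvPolynomial (Fin 2) ℂ :=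
  C (-2) * (X 0 + C (4 * lam * (γ + 3 * δ * lam)) * X 1) + C (2 * Complex.I * a 1)

/-- `ϑ_{1,1}` as a polynomial in `(x, t)`. -/
def vartheta1Poly : MvPolynomial (Fin 2) ℂ :=
  C (-4 * Complex.I * (γ + 6 * δ * lam)) * X 1 - C (2 * a 2)

/-- `ϑ_{1,2}` as a polynomial in `(x, t)`. -/
def vartheta2Poly : MvPolynomial (Fin 2) ℂ :=
  C (8 * (δ : ℂ)) * X 1 - C (2 * Complex.I * a 3)

theorem vartheta0Poly_mem : vartheta0Poly lam γ δ a ∈ degLE (Fin 2) ℂ 1 :=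
  add_mem (C_mul_mem_degLE _ (add_mem (X_mem_degLE _) (C_mul_mem_degLE _ (X_mem_degLE _))))
    (C_mem_degLE _ zero_le_one)

theorem vartheta1Poly_mem : vartheta1Poly lam γ δ a ∈ degLE (Fin 2) ℂ 1 :=
  sub_mem (C_mul_mem_degLE _ (X_mem_degLE _)) (C_mem_degLE _ zero_le_one)

theorem vartheta2Poly_mem : vartheta2Poly δ a ∈ degLE (Fin 2) ℂ 1 :=
  sub_mem (C_mul_mem_degLE _ (X_mem_degLE _)) (C_mem_degLE _ zero_le_one)

/-- `f_{1,l}` as a polynomial in `(x, t)`. -/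
def fPoly (l : ℕ) : MvPolynomial (Fin 2) ℂ :=
  expCoeffPoly (vartheta0Poly lam γ δ a) (vartheta1Poly lam γ δ a) (vartheta2Poly δ a) l

theorem eval_vartheta0Poly (x t : ℝ) :
    eval ![(x : ℂ), (t : ℂ)] (vartheta0Poly lam γ δ a) = vartheta0 lam γ δ a x t := by
  simp [vartheta0Poly, vartheta0]

theorem eval_fPoly (x t : ℝ) (l : ℕ) :
    eval ![(x : ℂ), (t : ℂ)] (fPoly lam γ δ a l) = f lam γ δ a x t l := by
  rw [fPoly, eval_expCoeffPoly, eval_vartheta0Poly, f]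
  simp [vartheta1Poly, vartheta1, vartheta2Poly, vartheta2]

/-- The Toeplitz factor of `F₁`, conjugated by the diagonal factor of `B₁`. -/
def scaledToeplitz : Matrix (Fin N) (Fin N) (MvPolynomial (Fin 2) ℂ) :=
  Matrix.of fun i j => if i ≤ j then
    C (((-2 * lam.im : ℝ) : ℂ) ^ ((j : ℕ) - (i : ℕ))) * fPoly lam γ δ a ((j : ℕ) - (i : ℕ)) else 0

/-- The leading parts of the entries of `scaledToeplitz`. -/
def leadToeplitz : Matrix (Fin N) (Fin N) (MvPolynomial (Fin 2) ℂ) :=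
  Matrix.of fun i j => if i ≤ j then C ((((j : ℕ) - (i : ℕ)).factorial : ℂ)⁻¹) *
    (C ((-2 * lam.im : ℝ) : ℂ) * vartheta0Poly lam γ δ a) ^ ((j : ℕ) - (i : ℕ)) else 0

theorem scaledToeplitz_sameTop (i j : Fin N) :
    SameTop ((j : ℤ) - (i : ℤ)) (scaledToeplitz N lam γ δ a i j) (leadToeplitz N lam γ δ a i j) := by
  simp only [scaledToeplitz, leadToeplitz, Matrix.of_apply]
  split_ifs with h
  · have h' : (j : ℤ) - (i : ℤ) = ((j - i : ℕ) : ℤ) := by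
      have : (i : ℕ) ≤ j := h
      lia
    have key := (expCoeffPoly_sameTop (vartheta0Poly_mem lam γ δ a) (vartheta1Poly_mem lam γ δ a)
      (vartheta2Poly_mem δ a) (j - i)).smul (((-2 * lam.im : ℝ) : ℂ) ^ ((j : ℕ) - (i : ℕ)))
    rw [h', fPoly, mul_pow, ← C_pow, mul_left_comm, ← C_mul', ← C_mul'] at *
    exact key
  · exact SameTop.refl (zero_mem _)

/-- The Toeplitz factor of `F₁`, conjugated by a factor `G` of `B₁ = β G† G`. -/
def conjToeplitz : Matrix (Fin N) (Fin N) (MvPolynomial (Fin 2) ℂ) :=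
  (pascal N).map C * scaledToeplitz N lam γ δ a * ((pascal N)⁻¹).map C

theorem conjToeplitz_sameTop (i j : Fin N) :
    SameTop ((j : ℤ) - (i : ℤ)) (conjToeplitz N lam γ δ a i j) (leadToeplitz N lam γ δ a i j) := by
  have := SameTop.matrix_mul (fun i : Fin N => (i : ℤ)) (fun i : Fin N => (i : ℤ))
    (fun i : Fin N => (i : ℤ))
    (SameTop.matrix_mul (fun i : Fin N => (i : ℤ)) (fun i : Fin N => (i : ℤ))
      (fun i : Fin N => (i : ℤ))
      (sameTop_of_unitriangular (pascal_blockTriangular N) (by simp [pascal]))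
      (scaledToeplitz_sameTop N lam γ δ a))
    (sameTop_of_unitriangular (inv_blockTriangular N) (pascal_inv_diag N)) i j
  rwa [one_mul, mul_one] at this

theorem det_conjToeplitz : (conjToeplitz N lam γ δ a).det = 1 := by
  have h : (scaledToeplitz N lam γ δ a).BlockTriangular id := fun i j h => by
    simp only [scaledToeplitz, Matrix.of_apply]
    exact if_neg (not_le.2 h)
  have hC : ∀ K : Matrix (Fin N) (Fin N) ℂ,
      (K.map C).det = (C K.det : MvPolynomial (Fin 2) ℂ) := fun K => (RingHom.map_det C K).symm
  rw [conjToeplitz, Matrix.det_mul, Matrix.det_mul, hC, hC, mul_right_comm, ← map_mul,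
    ← Matrix.det_mul, Matrix.mul_nonsing_inv _ (by simp [det_pascal]),
    Matrix.det_of_isUpperTriangular h]
  simp [scaledToeplitz, fPoly, expCoeffPoly]

/-- In each nonzero Leibniz term the exponents `j + c - τ c` sum to `j (N - j)`, whatever the
permutation, so a common power of `w` factors out and leaves `Γ_j`. -/
theorem cornerMinor_leadToeplitz {j : ℕ} (hj : j ≤ N) :
    cornerMinor (Nat.sub_le N j) (leadToeplitz N lam γ δ a) =
      C (Gam N j : ℂ) *
        (C ((-2 * lam.im : ℝ) : ℂ) * vartheta0Poly lam γ δ a) ^ (j * (N - j)) := by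
  set w := C ((-2 * lam.im : ℝ) : ℂ) * vartheta0Poly lam γ δ a with hw
  have hG : (Gam N j : ℂ) = Matrix.det (Matrix.of fun r c : Fin (N - j) =>
      if (r : ℕ) ≤ j + (c : ℕ) then (((j + (c : ℕ) - (r : ℕ)).factorial : ℂ))⁻¹ else 0) := by
    rw [Gam, ← Complex.ofRealHom_eq_coe, RingHom.map_det]
    congr 1
    ext r c
    simp [apply_ite (Complex.ofReal)]
  rw [hG, cornerMinor, RingHom.map_det, Matrix.det_apply', Matrix.det_apply', Finset.sum_mul]
  refine Finset.sum_congr rfl fun τ _ => ?_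
  rw [mul_assoc]
  congr 1
  have hentry : ∀ c : Fin (N - j), (leadToeplitz N lam γ δ a).submatrix
      (fun r : Fin (N - j) => (⟨r, by lia⟩ : Fin N))
      (fun c : Fin (N - j) => (⟨N - (N - j) + c, by lia⟩ : Fin N)) (τ c) c =
      if (τ c : ℕ) ≤ j + (c : ℕ) then
        C (((j + (c : ℕ) - (τ c : ℕ)).factorial : ℂ))⁻¹ * w ^ (j + (c : ℕ) - (τ c : ℕ)) else 0 := by
    intro c
    have hjj : N - (N - j) = j := by lia
    simp only [leadToeplitz, Matrix.submatrix_apply, Matrix.of_apply, Fin.mk_le_mk, hjj, ← hw]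
  rw [Finset.prod_congr rfl fun c _ => hentry c]
  by_cases h : ∀ c : Fin (N - j), (τ c : ℕ) ≤ j + (c : ℕ)
  · have hsum : ∑ c : Fin (N - j), (j + (c : ℕ) - (τ c : ℕ)) = j * (N - j) := by
      have h1 : ∑ c : Fin (N - j), (j + (c : ℕ) - (τ c : ℕ)) + ∑ c : Fin (N - j), (τ c : ℕ) =
          ∑ c : Fin (N - j), (j + (c : ℕ)) := by
        rw [← Finset.sum_add_distrib]
        exact Finset.sum_congr rfl fun c _ => Nat.sub_add_cancel (h c)
      rw [Equiv.sum_comp τ (fun c : Fin (N - j) => (c : ℕ)), Finset.sum_add_distrib,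
        Finset.sum_const, Finset.card_fin, smul_eq_mul] at h1
      linarith
    rw [← hsum, ← Finset.prod_pow_eq_pow_sum, ← Finset.prod_mul_distrib]
    exact Finset.prod_congr rfl fun c _ => by simp [h c]
  -- An index below the diagonal gives a zero factor on both sides; truncated subtraction of
  -- exponents never matters.
  · push Not at h
    obtain ⟨c, hc⟩ := h
    rw [Finset.prod_eq_zero (Finset.mem_univ c) (if_neg (not_le.2 hc)),
      Finset.prod_eq_zero (Finset.mem_univ c) (by simp [not_le.2 hc]), zero_mul]

end Phases

/-- At real points, conjugating values amounts to conjugating coefficients; thus the entries of `W†`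
are polynomials in `(x, t)` too. -/
theorem eval_map_conj {σ : Type*} (u : σ → ℂ) (hu : ∀ i, conj (u i) = u i)
    (p : MvPolynomial σ ℂ) :
    eval u (map (starRingEnd ℂ) p) = conj (eval u p) := by
  induction p using MvPolynomial.induction_on with
  | C c => simp
  | add p q hp hq => simp [hp, hq]
  | mul_X p i hp => simp [hp, hu]

/-- The relation `G U = W G` moves `G` to the outside: `U†G†G U = G†(W†W)G`. -/
theorem det_gram_add {n : Type*} [Fintype n] [DecidableEq n] {G U W : Matrix n n ℂ}
    (h : G * U = W * G) (β s : ℂ) :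
    ((s • U)ᴴ * (β • (Gᴴ * G)) * (s • U) + β • (Gᴴ * G)).det =
      β ^ Fintype.card n * (star G.det * G.det) * (1 + (star s * s) • (Wᴴ * W)).det := by
  have e : (s • U)ᴴ * (β • (Gᴴ * G)) * (s • U) + β • (Gᴴ * G) =
      β • (Gᴴ * (1 + (star s * s) • (Wᴴ * W)) * G) := by
    have h' : Uᴴ * (Gᴴ * G) * U = Gᴴ * (Wᴴ * W) * G := by
      calc Uᴴ * (Gᴴ * G) * U = (G * U)ᴴ * (G * U) := by
            rw [conjTranspose_mul]
            simp only [Matrix.mul_assoc]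
        _ = Gᴴ * (Wᴴ * W) * G := by
            rw [h, conjTranspose_mul]
            simp only [Matrix.mul_assoc]
    rw [conjTranspose_smul]
    simp only [Matrix.smul_mul, Matrix.mul_smul, h', Matrix.mul_add, Matrix.add_mul,
      Matrix.mul_one, smul_add, smul_smul]
    rw [add_comm]
    congr 2
    ring
  rw [e, det_smul, det_mul, det_mul, det_conjTranspose]
  ring

/-! ### Gram factorization of `B₁` and the minors of `W†W`. -/

section Gram

variable (N : ℕ) (lam : ℂ) (γ δ : ℝ) (a : Fin 4 → ℂ)

/-- A factor `G` of `B₁ = β G† G`. -/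
def gramFactor : Matrix (Fin N) (Fin N) ℂ :=
  pascal N * Matrix.diagonal fun i : Fin N => (((-1 / (2 * lam.im) : ℝ) : ℂ) ^ (i : ℕ))

theorem one_div_sub_conj : 1 / (lam - conj lam) = -Complex.I * ((1 / (2 * lam.im) : ℝ) : ℂ) := by
  rw [Complex.sub_conj]
  push_cast
  rw [one_div, mul_inv, Complex.inv_I]
  ring

theorem I_div_conj_sub : Complex.I / (conj lam - lam) = ((-1 / (2 * lam.im) : ℝ) : ℂ) := by
  rw [← neg_sub lam, div_neg, div_eq_mul_one_div, one_div_sub_conj, mul_comm Complex.I,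
    mul_right_comm, neg_mul, Complex.I_mul_I]
  push_cast
  ring

theorem B_eq_gram :
    B N lam = (1 / (lam - conj lam)) • ((gramFactor N lam)ᴴ * gramFactor N lam) := by
  have hP : (pascal N)ᴴ = (pascal N)ᵀ := by
    ext i j
    simp [pascal]
  have hG : (gramFactor N lam)ᴴ * gramFactor N lam =
      Matrix.diagonal (fun i : Fin N => (((-1 / (2 * lam.im) : ℝ) : ℂ) ^ (i : ℕ))) *
        ((pascal N)ᵀ * pascal N) *
      Matrix.diagonal fun i : Fin N => (((-1 / (2 * lam.im) : ℝ) : ℂ) ^ (i : ℕ)) := by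
    rw [gramFactor, conjTranspose_mul, hP, diagonal_conjTranspose]
    have : star (fun i : Fin N => (((-1 / (2 * lam.im) : ℝ) : ℂ) ^ (i : ℕ))) =
        fun i : Fin N => (((-1 / (2 * lam.im) : ℝ) : ℂ) ^ (i : ℕ)) := by
      funext i
      simp only [Pi.star_apply, star_pow, Complex.star_def, Complex.conj_ofReal]
    rw [this]
    simp only [Matrix.mul_assoc]
  ext i j
  rw [hG, Matrix.smul_apply, Matrix.mul_diagonal, Matrix.diagonal_mul, pascal_transpose_mul, B,
    Matrix.of_apply, I_div_conj_sub, smul_eq_mul, pow_add]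
  ring

theorem det_gramFactor_sq :
    star (gramFactor N lam).det * (gramFactor N lam).det =
      (((-1 / (2 * lam.im)) ^ (N * (N - 1)) : ℝ) : ℂ) := by
  have h : (gramFactor N lam).det =
      (((-1 / (2 * lam.im)) ^ (∑ i ∈ Finset.range N, i) : ℝ) : ℂ) := by
    rw [gramFactor, det_mul, det_pascal, one_mul, det_diagonal, Finset.prod_pow_eq_pow_sum,
      Fin.sum_univ_eq_sum_range (fun i => i), Complex.ofReal_pow]
  rw [h, Complex.star_def, Complex.conj_ofReal, ← Complex.ofReal_mul, ← pow_add, ← mul_two,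
    Finset.sum_range_id_mul_two]

/-- The Toeplitz factor of `F₁`. -/
def toeplitz (x t : ℝ) : Matrix (Fin N) (Fin N) ℂ :=
  Matrix.of fun i j : Fin N => if i ≤ j then f lam γ δ a x t ((j : ℕ) - (i : ℕ)) else 0

/-- Conjugation by `diag (q ^ i)` multiplies the superdiagonal `j - i` by `q^(-(j-i)) = (-2
λ_{1I})^(j-i)`, which is the scaling in `scaledToeplitz`; the Pascal factor then conjugates the
result. -/
theorem gramFactor_mul_toeplitz (hlam : lam.im ≠ 0) (x t : ℝ) :
    gramFactor N lam * toeplitz N lam γ δ a x t =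
      (conjToeplitz N lam γ δ a).map (eval ![(x : ℂ), (t : ℂ)]) * gramFactor N lam := by
  set u : Fin 2 → ℂ := ![(x : ℂ), (t : ℂ)] with hu
  have hC : ∀ K : Matrix (Fin N) (Fin N) ℂ, (K.map C).map (eval u) = K := fun K => by
    ext i j
    simp
  have hU : Matrix.diagonal (fun i : Fin N => (((-1 / (2 * lam.im) : ℝ) : ℂ) ^ (i : ℕ))) *
      toeplitz N lam γ δ a x t = (scaledToeplitz N lam γ δ a).map (eval u) *
      Matrix.diagonal (fun i : Fin N => (((-1 / (2 * lam.im) : ℝ) : ℂ) ^ (i : ℕ))) := by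
    ext i j
    rw [Matrix.diagonal_mul, Matrix.mul_diagonal, Matrix.map_apply]
    simp only [toeplitz, scaledToeplitz, Matrix.of_apply]
    split_ifs with h
    · have h' : (i : ℕ) ≤ j := h
      have hκ : ((-2 * lam.im : ℝ) : ℂ) * ((-1 / (2 * lam.im) : ℝ) : ℂ) = 1 := by
        rw [← Complex.ofReal_mul, ← Complex.ofReal_one]
        congr 1
        field_simp
      rw [map_mul, eval_C, hu, eval_fPoly]
      have hq : ((-1 / (2 * lam.im) : ℝ) : ℂ) ^ (j : ℕ) =
          ((-1 / (2 * lam.im) : ℝ) : ℂ) ^ ((j : ℕ) - (i : ℕ)) *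
            ((-1 / (2 * lam.im) : ℝ) : ℂ) ^ (i : ℕ) := by
        rw [← pow_add, Nat.sub_add_cancel h']
      have hκ' := congrArg (· ^ ((j : ℕ) - (i : ℕ))) hκ
      simp only [mul_pow, one_pow] at hκ'
      rw [hq]
      linear_combination (-f lam γ δ a x t (j - i) *
        ((-1 / (2 * lam.im) : ℝ) : ℂ) ^ (i : ℕ)) * hκ'
    · simp
  rw [gramFactor, Matrix.mul_assoc, hU, conjToeplitz, Matrix.map_mul, Matrix.map_mul, hC, hC,
    Matrix.mul_assoc, Matrix.mul_assoc, ← Matrix.mul_assoc (pascal N)⁻¹,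
    pascal_inv_mul, Matrix.one_mul]

/-- The coefficient of `exp (2 k (θ₁ + θ₁*))` in the determinant of `M`, up to a constant. -/
def minorSum (k : ℕ) : MvPolynomial (Fin 2) ℂ :=
  ∑ s ∈ (Finset.univ : Finset (Fin N)).powersetCard k,
    ((((conjToeplitz N lam γ δ a).map (map (starRingEnd ℂ)))ᵀ *
      conjToeplitz N lam γ δ a).submatrix (Subtype.val : s → Fin N) Subtype.val).det

theorem eval_minorSum (x t : ℝ) (k : ℕ) :
    eval ![(x : ℂ), (t : ℂ)] (minorSum N lam γ δ a k) =
      ∑ s ∈ (Finset.univ : Finset (Fin N)).powersetCard k,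
        ((((conjToeplitz N lam γ δ a).map (eval ![(x : ℂ), (t : ℂ)]))ᴴ *
          (conjToeplitz N lam γ δ a).map (eval ![(x : ℂ), (t : ℂ)])).submatrix
            (Subtype.val : s → Fin N) Subtype.val).det := by
  rw [minorSum, map_sum]
  refine Finset.sum_congr rfl fun s _ => ?_
  rw [RingHom.map_det]
  congr 1
  ext i j
  have hu : ∀ i, conj (![(x : ℂ), (t : ℂ)] i) = ![(x : ℂ), (t : ℂ)] i := fun i => by
    fin_cases i <;> simp
  simp [Matrix.mul_apply, eval_map_conj _ hu]

theorem minorSum_zero : minorSum N lam γ δ a 0 = 1 := by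
  simp [minorSum]

theorem minorSum_self : minorSum N lam γ δ a N = 1 := by
  have h : (Finset.univ : Finset (Fin N)).powersetCard N = {Finset.univ} := by
    simpa using Finset.powersetCard_self (Finset.univ : Finset (Fin N))
  rw [minorSum, h, Finset.sum_singleton]
  have e := Matrix.det_submatrix_equiv_self
    (Equiv.subtypeUnivEquiv (p := (· ∈ (Finset.univ : Finset (Fin N)))) Finset.mem_univ)
    (((conjToeplitz N lam γ δ a).map (map (starRingEnd ℂ)))ᵀ * conjToeplitz N lam γ δ a)
  have hm : ((conjToeplitz N lam γ δ a).map (map (starRingEnd ℂ))).det = 1 := by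
    have := RingHom.map_det (map (starRingEnd ℂ)) (conjToeplitz N lam γ δ a)
    rw [det_conjToeplitz, map_one] at this
    exact this.symm
  rw [det_mul, det_transpose, hm, det_conjToeplitz, one_mul] at e
  rw [← e]
  rfl

/-- The leading part of `minorSum`. -/
def leadMinorSum (j : ℕ) : MvPolynomial (Fin 2) ℂ :=
  (C (Gam N j : ℂ) * map (starRingEnd ℂ)
    (C ((-2 * lam.im : ℝ) : ℂ) * vartheta0Poly lam γ δ a) ^ (j * (N - j))) *
  (C (Gam N j : ℂ) * (C ((-2 * lam.im : ℝ) : ℂ) * vartheta0Poly lam γ δ a) ^ (j * (N - j)))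

theorem minorSum_sameTop {j : ℕ} (hj : j ≤ N) :
    SameTop ((2 * j * (N - j) : ℕ) : ℤ) (minorSum N lam γ δ a (N - j))
      (leadMinorSum N lam γ δ a j) := by
  have hT := conjToeplitz_sameTop N lam γ δ a
  have h1 := sum_minors_sameTop (Nat.sub_le N j) (fun i k => (hT i k).left)
    fun i k => ((hT i k).map (starRingEnd ℂ)).left
  have hc := SameTop.cornerMinor (Nat.sub_le N j) hT
  rw [cornerMinor_leadToeplitz N lam γ δ a hj] at hc
  have hc' : cornerMinor (Nat.sub_le N j) ((conjToeplitz N lam γ δ a).map (map (starRingEnd ℂ))) =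
      map (starRingEnd ℂ) (cornerMinor (Nat.sub_le N j) (conjToeplitz N lam γ δ a)) :=
    (RingHom.map_det (map (starRingEnd ℂ)) _).symm
  have h2 := (hc.map (starRingEnd ℂ)).mul hc
  rw [← hc', map_mul, map_C, Complex.conj_ofReal, map_pow] at h2
  have e1 : (2 * ((N - j : ℕ) : ℤ) * (N - ((N - j : ℕ) : ℤ))) = ((2 * j * (N - j) : ℕ) : ℤ) := by
    push_cast [Nat.cast_sub hj]
    ring
  have e2 : ((N - j : ℕ) : ℤ) * (N - ((N - j : ℕ) : ℤ)) +
      ((N - j : ℕ) : ℤ) * (N - ((N - j : ℕ) : ℤ)) = ((2 * j * (N - j) : ℕ) : ℤ) := by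
    push_cast [Nat.cast_sub hj]
    ring
  rw [e2] at h2
  have h1' : SameTop ((2 * j * (N - j) : ℕ) : ℤ) (minorSum N lam γ δ a (N - j)) _ := e1 ▸ h1
  exact h1'.trans h2

theorem eval_leadMinorSum (x t : ℝ) (j : ℕ) :
    eval ![(x : ℂ), (t : ℂ)] (leadMinorSum N lam γ δ a j) =
      (((2 * lam.im) ^ (2 * j * (N - j)) * Gam N j ^ 2 *
        ‖vartheta0 lam γ δ a x t‖ ^ (2 * j * (N - j)) : ℝ) : ℂ) := by
  have hu : ∀ i, conj (![(x : ℂ), (t : ℂ)] i) = ![(x : ℂ), (t : ℂ)] i := fun i => by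
    fin_cases i <;> simp
  rw [leadMinorSum]
  simp only [map_mul, map_pow, eval_map_conj _ hu, eval_C, eval_vartheta0Poly, map_C,
    Complex.conj_ofReal]
  set v := vartheta0 lam γ δ a x t
  have h : (((-2 * lam.im : ℝ) : ℂ) * conj v) * (((-2 * lam.im : ℝ) : ℂ) * v) =
      (((2 * lam.im) ^ 2 * ‖v‖ ^ 2 : ℝ) : ℂ) := by
    have := Complex.conj_mul' v
    push_cast
    linear_combination (4 * (lam.im : ℂ) ^ 2) * this
  rw [mul_mul_mul_comm, ← mul_pow, h, mul_assoc 2, pow_mul, pow_mul]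
  push_cast
  ring

end Gram

/-! ### Assembly of the expansion. -/

variable (N : ℕ) (lam : ℂ) (γ δ : ℝ) (a : Fin 4 → ℂ)

theorem star_exp_mul_exp (x t : ℝ) :
    star (Complex.exp (2 * theta lam γ δ a x t)) * Complex.exp (2 * theta lam γ δ a x t) =
      Complex.exp (2 * (theta lam γ δ a x t + conj (theta lam γ δ a x t))) := by
  rw [Complex.star_def, ← Complex.exp_conj, ← Complex.exp_add, map_mul, Complex.conj_ofNat]
  congr 1
  ring

/-- The determinant of `B₁`. -/
def detB : ℂ :=
  (-Complex.I) ^ N * (((2 * lam.im) ^ (-(N : ℤ) ^ 2) : ℝ) : ℂ)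

theorem detB_eq (hlam : lam.im ≠ 0) :
    (1 / (lam - conj lam)) ^ N * (star (gramFactor N lam).det * (gramFactor N lam).det) =
      detB N lam := by
  rw [det_gramFactor_sq, one_div_sub_conj, mul_pow, mul_assoc, ← Complex.ofReal_pow,
    ← Complex.ofReal_mul, detB]
  congr 2
  have h2 : (2 * lam.im) ≠ 0 := mul_ne_zero two_ne_zero hlam
  -- The sign disappears because `N (N - 1)` is even.
  have he : (-1 / (2 * lam.im)) ^ (N * (N - 1)) = (1 / (2 * lam.im)) ^ (N * (N - 1)) := by
    rw [neg_div, (Nat.even_mul_pred_self N).neg_pow]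
  have hN : N + N * (N - 1) = N ^ 2 := by
    rcases N with _ | n
    · simp
    · rw [Nat.add_sub_cancel]
      ring
  rw [he, ← pow_add, hN, one_div, _root_.zpow_neg, inv_pow]
  norm_cast

/-- The determinant of `M` as a polynomial in `exp (2 (θ₁ + θ₁*))`. -/
theorem det_M_eq_sum (hlam : lam.im ≠ 0) (x t : ℝ) :
    (M N lam γ δ a x t).det = ∑ j ∈ Finset.range (N + 1),
      Complex.exp (2 * ((N - j : ℕ) : ℂ) *
        (theta lam γ δ a x t + conj (theta lam γ δ a x t))) *
      (detB N lam * eval ![(x : ℂ), (t : ℂ)] (minorSum N lam γ δ a (N - j))) := by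
  have hF : F N lam γ δ a x t =
      Complex.exp (2 * theta lam γ δ a x t) • toeplitz N lam γ δ a x t := rfl
  rw [M, hF, B_eq_gram, det_gram_add (gramFactor_mul_toeplitz N lam γ δ a hlam x t),
    Fintype.card_fin, detB_eq N lam hlam, star_exp_mul_exp, det_one_add_smul_eq_sum_minors,
    Fintype.card_fin, ← Finset.sum_range_reflect, Finset.mul_sum]
  refine Finset.sum_congr rfl fun j _ => ?_
  rw [eval_minorSum, Nat.add_sub_cancel, ← Complex.exp_nat_mul, mul_left_comm]
  congr 2
  ring

theorem detB_mul_eval_leadMinorSum (hlam : lam.im ≠ 0) {j : ℕ} (hj : j ≤ N) (x t : ℝ) :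
    detB N lam * eval ![(x : ℂ), (t : ℂ)] (leadMinorSum N lam γ δ a j) = A N lam γ δ a j x t := by
  have h2 : (2 * lam.im) ≠ 0 := mul_ne_zero two_ne_zero hlam
  -- This is `(N - j)² + j² = N² - 2j(N - j)`: the scaling of `w` supplies the difference from the
  -- exponent in `det B₁`.
  have hz : (2 * lam.im) ^ (-((N : ℤ) - (j : ℤ)) ^ 2 - (j : ℤ) ^ 2) =
      (2 * lam.im) ^ (-(N : ℤ) ^ 2) * (2 * lam.im) ^ (2 * j * (N - j)) := by
    rw [← zpow_natCast, ← zpow_add₀ h2]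
    congr 1
    push_cast [Nat.cast_sub hj]
    ring
  rw [eval_leadMinorSum, detB, A, mul_assoc, ← Complex.ofReal_mul, hz]
  congr 2
  ring

theorem Gam_zero : Gam N 0 = 1 := by
  rw [Gam, Matrix.det_of_isUpperTriangular]
  · simp
  · intro i j h
    simpa using fun h' : i ≤ j => absurd h (not_lt.2 h')

theorem A_zero (x t : ℝ) : A N lam γ δ a 0 x t = detB N lam := by
  simp [A, detB, Gam_zero]

end HirotaSoliton
end

open HirotaSoliton ComplexConjugate in
theorem lemma4p3 (N : ℕ) (hN : 1 ≤ N) (lam : ℂ) (hlam : lam.im ≠ 0) (γ δ : ℝ) (a : Fin 4 → ℂ) :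
    ∃ R : ℕ → MvPolynomial (Fin 2) ℂ,
      (∀ j : ℕ, 1 ≤ j → j < N → (R j).totalDegree < 2 * j * (N - j)) ∧
      ∀ x t : ℝ,
        (HirotaSoliton.M N lam γ δ a x t).det =
          (∑ j ∈ Finset.range N,
            Complex.exp (2 * ((N - j : ℕ) : ℂ) *
                (theta lam γ δ a x t + conj (theta lam γ δ a x t))) *
              HirotaSoliton.A N lam γ δ a j x t)
          + HirotaSoliton.A N lam γ δ a 0 x t
          + ∑ j ∈ Finset.Ico 1 N,
              Complex.exp (2 * ((N - j : ℕ) : ℂ) *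
                  (theta lam γ δ a x t + conj (theta lam γ δ a x t))) *
                MvPolynomial.eval ![(x : ℂ), (t : ℂ)] (R j) := by
  -- Each remainder is `det B₁` times the minor sum minus its leading part. The extreme terms `j =
  -- 0` and `j = N` are exact, so they are split off and only `1 ≤ j < N` carry a remainder.
  refine ⟨fun j => MvPolynomial.C (detB N lam) *
    (minorSum N lam γ δ a (N - j) - leadMinorSum N lam γ δ a j), fun j hj hjN => ?_, fun x t => ?_⟩
  · exact totalDegree_lt_of_mem_degLE (Nat.mul_pos (by lia) (by lia))
      (C_mul_mem_degLE _ (minorSum_sameTop N lam γ δ a hjN.le).sub)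
  · rw [det_M_eq_sum N lam γ δ a hlam, Finset.sum_range_succ, Finset.range_eq_Ico,
      Finset.sum_eq_sum_Ico_succ_bot hN, Finset.sum_eq_sum_Ico_succ_bot hN, zero_add]
    have hmid : ∑ j ∈ Finset.Ico 1 N, Complex.exp (2 * ((N - j : ℕ) : ℂ) *
          (theta lam γ δ a x t + conj (theta lam γ δ a x t))) *
        (detB N lam * MvPolynomial.eval ![(x : ℂ), (t : ℂ)] (minorSum N lam γ δ a (N - j))) =
        (∑ j ∈ Finset.Ico 1 N, Complex.exp (2 * ((N - j : ℕ) : ℂ) *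
          (theta lam γ δ a x t + conj (theta lam γ δ a x t))) * A N lam γ δ a j x t) +
        ∑ j ∈ Finset.Ico 1 N, Complex.exp (2 * ((N - j : ℕ) : ℂ) *
          (theta lam γ δ a x t + conj (theta lam γ δ a x t))) *
          MvPolynomial.eval ![(x : ℂ), (t : ℂ)] (MvPolynomial.C (detB N lam) *
            (minorSum N lam γ δ a (N - j) - leadMinorSum N lam γ δ a j)) := by
      rw [← Finset.sum_add_distrib]
      refine Finset.sum_congr rfl fun j hj => ?_
      rw [← detB_mul_eval_leadMinorSum N lam γ δ a hlam (Finset.mem_Ico.1 hj).2.le, map_mul,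
        map_sub, MvPolynomial.eval_C]
      ring
    rw [hmid, Nat.sub_zero, Nat.sub_self, minorSum_self, minorSum_zero, A_zero, map_one]
    simp only [Nat.cast_zero, mul_zero, zero_mul, Complex.exp_zero]
    ring
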